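/- **Setting.** A concurrent program consists of a finite set of processes (threads) with finitely many shared variables, a finite data domain and, per process, finitely many registers and instruction labels. Instructions are writes, reads, local assignments, conditional jumps, compare-and-swap (which needs an empty store buffer), and termination. A configuration records the current label and the register contents of every process, the FIFO store buffer of every process (a finite word of pending writes), and the shared memory. Its size is the total number of pending writes; it is *small* if its size is at most $4$. Under probabilistic TSO, one step of the Markov chain of the program is as follows. First, one of the enabled processes is drawn with probability proportional to given positive weights and executes its current instruction: a write is appended to the buffer of the process, and a read takes the newest pending write of the process to that variable, or the memory value if there is none. If no process is enabled, nothing changes in this part. Second, a word over the set of processes is drawn uniformly from the finitely many words along which the buffers can be flushed (each letter moves the oldest pending write of that process to the memory), and the buffers are flushed along this word. Let $\mathbb P_\gamma$ be the induced probability measure on runs $\rho=\rho_0\rho_1\rho_2\cdots$ with $\rho_0=\gamma$. Let $q=\tfrac23$, $p=1-q=\tfrac13$, $g=2\sqrt{pq}$, and, for a real number $\beta>1$, $$\alpha_1(\beta)=\frac{\beta}{\beta-1}\,(2\beta)^{1/\beta}\,\Bigl(\frac1\beta+\frac1g\Bigr)^{\lfloor 1/\beta\rfloor}\,g .$$ (The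 exponent $\lfloor 1/\beta\rfloor$ is $0$.) **Statement.** For every program, every label $\ell$, every small configuration $\gamma$, every real $\beta>1$ and every $n\in\mathbb N$, $$\mathbb P_\gamma\Bigl[\rho\text{ reaches }\ell\text{ for the first time at step }n\ \text{ and }\ \#\{i<n:\rho_i\text{ is small}\}\le\lfloor n/\beta\rfloor\Bigr]\ \le\ \alpha_1(\beta)^n .$$ Moreover $\alpha_1(150)<1$. -/

import Mathlib

open MeasureTheory ProbabilityTheory
open scoped NNReal ENNReal

noncomputable section

namespace PTSO

/-! ### Concurrent programs -/

/-- Statements of a thread with registers `R` and labels `Λ`, over the shared variables `X` and the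
data domain `V`.  Expressions are given by their values as functions of the register contents. -/
inductive Stmt (X V R Λ : Type*) where
  /-- `x := e`, a write, which goes to the store buffer -/
  | write (x : X) (e : (R → V) → V)
  /-- `a := x`, a read of a shared variable -/
  | read (a : R) (x : X)
  /-- `a := e`, a local assignment -/
  | assign (a : R) (e : (R → V) → V)
  /-- `if b then goto l` -/
  | branch (b : (R → V) → Prop) (l : Λ)
  /-- `CAS(x, e, e')`: needs an empty buffer, and blocks as long as `x` differs from `e` -/
  | cas (x : X) (e e' : (R → V) → V)
  /-- the compare-and-swap that needs an empty buffer but does not block on a mismatch; `f` says how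
  success (`True`) or failure (`False`) is recorded in the registers.  With `e = e'` and `f` the
  identity it is a memory fence. -/
  | tryCas (x : X) (e e' : (R → V) → V) (f : Prop → (R → V) → (R → V))
  /-- termination: no further step -/
  | term

/-- A concurrent program: thread `p` has registers `Reg p` and instruction labels `Lbl p`; `code`
gives the statement at a label, `next` the label of the instruction that follows it, and `weight` is
the positive weight that the probabilistic scheduler gives to the thread. -/
structure Program (Proc Var Val : Type*) (Reg Lbl : Proc → Type*) where
  code : ∀ p, Lbl p → Stmt Var Val (Reg p) (Lbl p)
  next : ∀ p, Lbl p → Lbl p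
  weight : Proc → ℝ≥0
  weight_pos : ∀ p, 0 < weight p

/-- Configurations: current labels, register contents, store buffers and shared memory.
The head of a buffer is its oldest pending write, new writes are appended at the end. -/
@[ext]
structure Conf (Proc Var Val : Type*) (Reg Lbl : Proc → Type*) where
  lbl : ∀ p, Lbl p
  reg : ∀ p, Reg p → Val
  buf : Proc → List (Var × Val)
  mem : Var → Val

variable {Proc Var Val : Type*} {Reg Lbl : Proc → Type*}

/-- Every set of configurations is measurable. -/
instance : MeasurableSpace (Conf Proc Var Val Reg Lbl) := ⊤

namespace Conf

/-- The size of a configuration: the total number of pending writes. -/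
def size [Fintype Proc] (γ : Conf Proc Var Val Reg Lbl) : ℕ := ∑ p, (γ.buf p).length

/-- Small configurations. -/
def Small [Fintype Proc] (γ : Conf Proc Var Val Reg Lbl) : Prop := γ.size ≤ 4

open scoped Classical in
/-- The value that thread `p` reads from `x`: the newest pending write of `p` to `x`, or the memory
value if there is none. -/
def readVal (γ : Conf Proc Var Val Reg Lbl) (p : Proc) (x : Var) : Val :=
  match (γ.buf p).reverse.find? (fun m => m.1 = x) with
  | some m => m.2
  | none => γ.mem x

open scoped Classical in
def setLbl (γ : Conf Proc Var Val Reg Lbl) (p : Proc) (l : Lbl p) : Conf Proc Var Val Reg Lbl :=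
  { γ with lbl := Function.update γ.lbl p l }

open scoped Classical in
def setRegs (γ : Conf Proc Var Val Reg Lbl) (p : Proc) (r : Reg p → Val) :
    Conf Proc Var Val Reg Lbl :=
  { γ with reg := Function.update γ.reg p r }

def setReg (γ : Conf Proc Var Val Reg Lbl) (p : Proc) (a : Reg p) (v : Val) :
    Conf Proc Var Val Reg Lbl :=
  open scoped Classical in γ.setRegs p (Function.update (γ.reg p) a v)

open scoped Classical in
def setBuf (γ : Conf Proc Var Val Reg Lbl) (p : Proc) (b : List (Var × Val)) :
    Conf Proc Var Val Reg Lbl :=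
  { γ with buf := Function.update γ.buf p b }

open scoped Classical in
def setMem (γ : Conf Proc Var Val Reg Lbl) (x : Var) (v : Val) : Conf Proc Var Val Reg Lbl :=
  { γ with mem := Function.update γ.mem x v }

/-- One memory update: the oldest pending write of `p`, if there is one, goes to the memory. -/
def flush (γ : Conf Proc Var Val Reg Lbl) (p : Proc) : Option (Conf Proc Var Val Reg Lbl) :=
  match γ.buf p with
  | [] => none
  | m :: b => some ((γ.setBuf p b).setMem m.1 m.2)

/-- The update transition along a sequence of threads: each of them in turn flushes one write. -/
def flushWord (γ : Conf Proc Var Val Reg Lbl) : List Proc → Option (Conf Proc Var Val Reg Lbl)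
  | [] => some γ
  | p :: w => (γ.flush p).bind fun γ' => γ'.flushWord w

/-- The sequences that label an update transition from `γ`. -/
def updateWords (γ : Conf Proc Var Val Reg Lbl) : Set (List Proc) :=
  {w | (γ.flushWord w).isSome}

theorem size_flush [Fintype Proc] {γ γ' : Conf Proc Var Val Reg Lbl} {p : Proc}
    (h : γ.flush p = some γ') : γ'.size + 1 = γ.size := by
  classical
  unfold flush at h
  split at h
  · simp at h
  · rename_i m b hb
    simp only [Option.some.injEq] at h
    subst h
    unfold size
    rw [← Finset.add_sum_erase Finset.univ (fun q => (γ.buf q).length) (Finset.mem_univ p),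
      ← Finset.add_sum_erase Finset.univ _ (Finset.mem_univ p)]
    have : ∀ q ∈ Finset.univ.erase p,
        (((γ.setBuf p b).setMem m.1 m.2).buf q).length = (γ.buf q).length := by
      intro q hq
      simp [setMem, setBuf, Function.update_of_ne (Finset.ne_of_mem_erase hq)]
    rw [Finset.sum_congr rfl this]
    simp only [setMem, setBuf, Function.update_self, hb, List.length_cons]
    omega

theorem length_le_of_mem_updateWords [Fintype Proc] (w : List Proc) :
    ∀ γ : Conf Proc Var Val Reg Lbl, w ∈ γ.updateWords → w.length ≤ γ.size := by
  induction w with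
  | nil => intro γ _; simp
  | cons p w ih =>
    intro γ h
    simp only [updateWords, Set.mem_ofPred_eq, flushWord] at h
    cases hf : γ.flush p with
    | none => simp [hf] at h
    | some γ' =>
      rw [hf] at h
      have h1 := ih γ' h
      have h2 := size_flush hf
      simp only [List.length_cons]
      omega

theorem finite_updateWords [Fintype Proc] (γ : Conf Proc Var Val Reg Lbl) :
    γ.updateWords.Finite :=
  (List.finite_length_le Proc γ.size).subset fun w hw => length_le_of_mem_updateWords w γ hw

/-- The update distribution: a sequence is drawn uniformly from all that label an update
transition.  So `γ'` has probability `#{w | w leads from γ to γ'} / #{w | w leads somewhere}`. -/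
def updatePMF [Fintype Proc] (γ : Conf Proc Var Val Reg Lbl) :
    PMF (Conf Proc Var Val Reg Lbl) :=
  (PMF.uniformOfFinset γ.finite_updateWords.toFinset
    ⟨[], by simp [updateWords, flushWord]⟩).map fun w => (γ.flushWord w).getD γ

end Conf

namespace Program

variable (P : Program Proc Var Val Reg Lbl)

open scoped Classical in
/-- The transition of thread `p` from `γ`, `none` if `p` is disabled. -/
def procStep (γ : Conf Proc Var Val Reg Lbl) (p : Proc) :
    Option (Conf Proc Var Val Reg Lbl) :=
  let γ' := γ.setLbl p (P.next p (γ.lbl p))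
  let r := γ.reg p
  match P.code p (γ.lbl p) with
  | .write x e => some (γ'.setBuf p (γ.buf p ++ [(x, e r)]))
  | .read a x => some (γ'.setReg p a (γ.readVal p x))
  | .assign a e => some (γ'.setReg p a (e r))
  | .branch b l => some (if b r then γ.setLbl p l else γ')
  | .cas x e e' =>
      if γ.buf p = [] ∧ γ.mem x = e r then some (γ'.setMem x (e' r)) else none
  | .tryCas x e e' f =>
      if γ.buf p = [] then
        if γ.mem x = e r then some ((γ'.setMem x (e' r)).setRegs p (f True r))
        else some (γ'.setRegs p (f False r))
      else none
  | .term => none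

def Enabled (γ : Conf Proc Var Val Reg Lbl) (p : Proc) : Prop := (P.procStep γ p).isSome

open scoped Classical in
def schedWeight (γ : Conf Proc Var Val Reg Lbl) (p : Proc) : ℝ≥0∞ :=
  if P.Enabled γ p then (P.weight p : ℝ≥0∞) else 0

theorem tsum_schedWeight_ne_zero {γ : Conf Proc Var Val Reg Lbl} (h : ∃ p, P.Enabled γ p) :
    ∑' p, P.schedWeight γ p ≠ 0 := by
  obtain ⟨p, hp⟩ := h
  intro h0
  have h1 := ENNReal.tsum_eq_zero.1 h0 p
  simp only [schedWeight, if_pos hp, ENNReal.coe_eq_zero] at h1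
  exact (P.weight_pos p).ne' h1

theorem tsum_schedWeight_ne_top [Fintype Proc] (γ : Conf Proc Var Val Reg Lbl) :
    ∑' p, P.schedWeight γ p ≠ ∞ := by
  rw [tsum_fintype]
  refine ENNReal.sum_ne_top.2 fun p _ => ?_
  unfold schedWeight
  split <;> simp

variable [Fintype Proc]

open scoped Classical in
/-- The distribution after the thread part of a step: an enabled thread is drawn with probability
proportional to its weight and makes its transition; if no thread is enabled, nothing changes. -/
def procPMF (γ : Conf Proc Var Val Reg Lbl) : PMF (Conf Proc Var Val Reg Lbl) :=
  if h : ∃ p, P.Enabled γ p then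
    (PMF.normalize (P.schedWeight γ) (P.tsum_schedWeight_ne_zero h)
      (P.tsum_schedWeight_ne_top γ)).map fun p => (P.procStep γ p).getD γ
  else PMF.pure γ

/-- One step of the Markov chain of the program: a thread transition, then an update transition. -/
def stepPMF (γ : Conf Proc Var Val Reg Lbl) : PMF (Conf Proc Var Val Reg Lbl) :=
  (P.procPMF γ).bind Conf.updatePMF

/-- The transition kernel of the Markov chain, as a function of the history up to time `n`. -/
def stepKernel (n : ℕ) :
    Kernel (Π _ : Finset.Iic n, Conf Proc Var Val Reg Lbl) (Conf Proc Var Val Reg Lbl) where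
  toFun h := (P.stepPMF (h ⟨n, Finset.mem_Iic.2 le_rfl⟩)).toMeasure
  measurable' := Measurable.comp
    (g := fun γ : Conf Proc Var Val Reg Lbl => (P.stepPMF γ).toMeasure)
    measurable_from_top (measurable_pi_apply _)

instance (n : ℕ) : IsMarkovKernel (P.stepKernel n) :=
  ⟨fun h => inferInstanceAs (IsProbabilityMeasure
    (P.stepPMF (h ⟨n, Finset.mem_Iic.2 le_rfl⟩)).toMeasure)⟩

/-- The probability measure on the runs of the program that start in `γ`. -/
def runMeasure (γ : Conf Proc Var Val Reg Lbl) : Measure (ℕ → Conf Proc Var Val Reg Lbl) :=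
  Kernel.traj (X := fun _ => Conf Proc Var Val Reg Lbl) P.stepKernel 0 fun _ => γ

end Program

/-! ### Runs -/

/-- The run `ρ` reaches the label `l` for the first time at step `n`. -/
def ReachesFirstAt (l : Σ p, Lbl p) (n : ℕ) (ρ : ℕ → Conf Proc Var Val Reg Lbl) : Prop :=
  (ρ n).lbl l.1 = l.2 ∧ ∀ i < n, (ρ i).lbl l.1 ≠ l.2

open scoped Classical in
/-- The number of visits of `ρ` to small configurations in its prefix of length `n`, that is, among
its first `n` configurations `ρ 0, …, ρ (n - 1)`. -/
def smallVisits [Fintype Proc] (n : ℕ) (ρ : ℕ → Conf Proc Var Val Reg Lbl) : ℕ :=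
  ((Finset.range n).filter fun i => (ρ i).Small).card

/-- The runs that reach `l` first at step `n` and whose prefixes of length `n` visit small
configurations at most `⌊n / β⌋` times. -/
def sRuns [Fintype Proc] (l : Σ p, Lbl p) (β : ℝ) (n : ℕ) :
    Set (ℕ → Conf Proc Var Val Reg Lbl) :=
  {ρ | ReachesFirstAt l n ρ ∧ smallVisits n ρ ≤ ⌊(n : ℝ) / β⌋₊}

/-! ### Constants -/

/-- The lower bound for the probability that a step from a configuration that is not small makes
it smaller. -/
def qStar : ℝ := 2 / 3

def pStar : ℝ := 1 - qStar

/-- The gravity parameter. -/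
def gravity : ℝ := 2 * √(pStar * qStar)

/-- The base `α₁` of the bound.  The exponent `⌊1 / β⌋` is `0` for `β > 1`. -/
def alphaOne (β : ℝ) : ℝ :=
  β / (β - 1) * (2 * β) ^ (1 / β) * (1 / β + 1 / gravity) ^ ⌊1 / β⌋₊ * gravity

end PTSO

end

noncomputable section

namespace PTSO

variable {Proc Var Val : Type*} {Reg Lbl : Proc → Type*}

/-! ### Expectations with respect to probability mass functions -/

/-! The bound already holds for the event of few small visits, by an exponential supermartingale.
Any update word that leaves a write pending can be extended by a letter, so the number of words of
length `k` is nondecreasing in `k` up to the size (`numWords_le_succ`). Long words therefore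
dominate: from size `s ≥ 5`, a step ends at size `s` or more with probability at most 1/3, and then
at most at `s + 1` (`three_mul_card_filter_le`).

For the weight √2 ^ (size - 4), where √2 = √(q/p), this gives mean growth by at most 2u/3 + 2u/3 =
4u/3 = `gravity` · √2 · u with u = √2 ^ (s - 5). From a small configuration the factor is at most √2
= (3/2) · `gravity`. Dividing the potential by the accumulated factors gives a supermartingale
started at 1 (`lintegral_prod_mul_potential_le`). The potential is at least 1, so Markov's
inequality bounds the probability of at most `k` small visits by `gravity` ^ n · (3/2) ^ k
(`runMeasure_smallVisits_le`). With k = ⌊n/β⌋ this lies below `alphaOne β ^ n`. -/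

theorem lintegral_toMeasure {α : Type*} [MeasurableSpace α] (μ : PMF α) {f : α → ℝ≥0∞}
    (hf : Measurable f) : ∫⁻ a, f a ∂μ.toMeasure = ∑' a, μ a * f a := by
  have h : μ.toMeasure = Measure.sum fun a => μ a • Measure.dirac a := by
    ext s hs
    rw [PMF.toMeasure_apply _ hs, Measure.sum_apply _ hs]
    refine tsum_congr fun a => ?_
    by_cases ha : a ∈ s <;> simp [Measure.dirac_apply' a hs, ha]
  rw [h, lintegral_sum_measure]
  refine tsum_congr fun a => ?_
  rw [lintegral_smul_measure, lintegral_dirac' a hf, smul_eq_mul]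

theorem tsum_bind_mul {α β : Type*} (μ : PMF α) (k : α → PMF β) (f : β → ℝ≥0∞) :
    ∑' b, μ.bind k b * f b = ∑' a, μ a * ∑' b, k a b * f b := by
  simp_rw [PMF.bind_apply, ← ENNReal.tsum_mul_right, ← ENNReal.tsum_mul_left]
  rw [ENNReal.tsum_comm]
  simp_rw [mul_assoc]

theorem tsum_map_mul {α β : Type*} (μ : PMF α) (k : α → β) (f : β → ℝ≥0∞) :
    ∑' b, μ.map k b * f b = ∑' a, μ a * f (k a) := by
  classical
  rw [← PMF.bind_pure_comp, tsum_bind_mul]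
  refine tsum_congr fun a => ?_
  rw [tsum_eq_single (k a) (by intro b hb; simp [PMF.pure_apply, hb])]
  simp

theorem tsum_mul_le_of_support {α : Type*} (μ : PMF α) {f : α → ℝ≥0∞} {c : ℝ≥0∞}
    (h : ∀ a ∈ μ.support, f a ≤ c) : ∑' a, μ a * f a ≤ c := by
  calc ∑' a, μ a * f a ≤ ∑' a, μ a * c := by
        refine ENNReal.tsum_le_tsum fun a => ?_
        by_cases ha : μ a = 0
        · simp [ha]
        · gcongr
          exact h a ((μ.mem_support_iff a).2 ha)
    _ = c := by rw [ENNReal.tsum_mul_right, μ.tsum_coe, one_mul]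

/-! ### Update words -/

namespace Conf

variable [Fintype Proc]

theorem size_flushWord (w : List Proc) : ∀ {γ δ : Conf Proc Var Val Reg Lbl},
    γ.flushWord w = some δ → δ.size + w.length = γ.size := by
  induction w with
  | nil =>
    intro γ δ h
    simp only [flushWord, Option.some.injEq] at h
    simp [h]
  | cons p w ih =>
    intro γ δ h
    simp only [flushWord, Option.bind_eq_some_iff] at h
    obtain ⟨γ', h1, h2⟩ := h
    have := ih h2
    have := size_flush h1
    simp only [List.length_cons]
    omega

theorem exists_flush_isSome {γ : Conf Proc Var Val Reg Lbl} (h : 0 < γ.size) :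
    ∃ p, (γ.flush p).isSome := by
  by_contra! hn
  have hb : ∀ p, γ.buf p = [] := by
    intro p
    have := hn p
    unfold flush at this
    split at this
    · assumption
    · simp at this
  simp [size, hb] at h

theorem exists_append_mem_updateWords (w : List Proc) : ∀ {γ : Conf Proc Var Val Reg Lbl},
    w ∈ γ.updateWords → w.length < γ.size → ∃ p, w ++ [p] ∈ γ.updateWords := by
  induction w with
  | nil =>
    intro γ _ hl
    obtain ⟨p, hp⟩ := exists_flush_isSome (γ := γ) (by simpa using hl)
    obtain ⟨δ, hδ⟩ := Option.isSome_iff_exists.1 hp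
    exact ⟨p, by simp [updateWords, flushWord, hδ]⟩
  | cons q w ih =>
    intro γ hw hl
    simp only [updateWords, Set.mem_ofPred_eq, flushWord] at hw
    cases hf : γ.flush q with
    | none => simp [hf] at hw
    | some γ' =>
      rw [hf] at hw
      have h1 := size_flush hf
      simp only [List.length_cons] at hl
      obtain ⟨p, hp⟩ := ih (γ := γ') hw (by omega)
      exact ⟨p, by simpa [updateWords, flushWord, hf] using hp⟩

/-- The number of update words of a given length. -/
def numWords (γ : Conf Proc Var Val Reg Lbl) (k : ℕ) : ℕ :=
  (γ.finite_updateWords.toFinset.filter fun w => w.length = k).card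

/-- Appending a possible flush to each word is injective, since dropping the last letter undoes it.
-/
theorem numWords_le_succ (γ : Conf Proc Var Val Reg Lbl) {k : ℕ} (hk : k < γ.size) :
    γ.numWords k ≤ γ.numWords (k + 1) := by
  have h : ∀ w : List Proc, ∃ w' : List Proc, w ∈ γ.updateWords → w.length = k →
      w' ∈ γ.updateWords ∧ ∃ p, w' = w ++ [p] := by
    intro w
    by_cases hw : w ∈ γ.updateWords ∧ w.length = k
    · obtain ⟨p, hp⟩ := exists_append_mem_updateWords w hw.1 (by omega)
      exact ⟨w ++ [p], fun _ _ => ⟨hp, p, rfl⟩⟩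
    · exact ⟨[], fun h1 h2 => absurd ⟨h1, h2⟩ hw⟩
  choose e he using h
  refine Finset.card_le_card_of_injOn e ?_ ?_
  · intro w hw
    simp only [Finset.coe_filter, Set.Finite.mem_toFinset, Set.mem_ofPred_eq] at hw ⊢
    obtain ⟨h1, p, h2⟩ := he w hw.1 hw.2
    exact ⟨h1, by simp [h2, hw.2]⟩
  · intro w hw v hv hwv
    simp only [Finset.coe_filter, Set.Finite.mem_toFinset, Set.mem_ofPred_eq] at hw hv
    obtain ⟨-, p, h1⟩ := he w hw.1 hw.2
    obtain ⟨-, q, h2⟩ := he v hv.1 hv.2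
    rw [h1, h2] at hwv
    exact (List.append_inj' hwv rfl).1

theorem card_filter_length_lt (γ : Conf Proc Var Val Reg Lbl) (m : ℕ) :
    (γ.finite_updateWords.toFinset.filter fun w => w.length < m).card =
      ∑ k ∈ Finset.range m, γ.numWords k := by
  rw [Finset.card_eq_sum_card_fiberwise (f := List.length) (t := Finset.range m)]
  · refine Finset.sum_congr rfl fun k hk => ?_
    rw [Finset.filter_filter, numWords]
    congr 1
    refine Finset.filter_congr fun w _ => ?_
    rw [Finset.mem_range] at hk
    constructor
    · exact fun h => h.2
    · exact fun h => ⟨by omega, h⟩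
  · intro w hw
    simpa using (Finset.mem_filter.1 (Finset.mem_coe.1 hw)).2

/-- After a thread transition from a configuration of size `s ≥ 5`, at most a third of the update
words does not bring the size below `s`. -/
theorem three_mul_card_filter_le (γ : Conf Proc Var Val Reg Lbl) {s : ℕ} (hs : 5 ≤ s)
    (h1 : γ.size = s ∨ γ.size = s + 1) :
    3 * (γ.finite_updateWords.toFinset.filter fun w => w.length < γ.size + 1 - s).card ≤
      γ.finite_updateWords.toFinset.card := by
  have h6 := Finset.card_filter_le γ.finite_updateWords.toFinset
    (fun w => w.length < γ.size + 1)
  have m : ∀ k < γ.size, γ.numWords k ≤ γ.numWords (k + 1) :=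
    fun k hk => γ.numWords_le_succ hk
  rw [card_filter_length_lt] at h6 ⊢
  rcases h1 with h1 | h1
  -- No write was added: only the empty word is bad, and lengths 0, 1, 2 suffice.
  · have h7 : ∑ k ∈ Finset.range 3, γ.numWords k ≤
        ∑ k ∈ Finset.range (γ.size + 1), γ.numWords k :=
      Finset.sum_le_sum_of_subset (Finset.range_subset_range.2 (by omega))
    have h8 : γ.size + 1 - s = 1 := by omega
    rw [h8]
    simp only [Finset.sum_range_succ, Finset.sum_range_zero] at h6 h7 ⊢
    have := m 0 (by omega)
    have := m 1 (by omega)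
    norm_num at *
    omega
  -- A write was added: lengths 0 and 1 are bad, and the pairs {2, 3} and {4, 5} each hold at least
  -- as many words. Length 5 is available because `s ≥ 5`.
  · have h7 : ∑ k ∈ Finset.range 6, γ.numWords k ≤
        ∑ k ∈ Finset.range (γ.size + 1), γ.numWords k :=
      Finset.sum_le_sum_of_subset (Finset.range_subset_range.2 (by omega))
    have h8 : γ.size + 1 - s = 2 := by omega
    rw [h8]
    have h60 := h7.trans h6
    simp only [Finset.sum_range_succ, Finset.sum_range_zero] at h60 ⊢
    have := m 0 (by omega)
    have := m 1 (by omega)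
    have := m 2 (by omega)
    have := m 3 (by omega)
    have := m 4 (by omega)
    norm_num at *
    omega

end Conf

/-! ### The potential -/

theorem gravity_eq : gravity = 2 / 3 * √2 := by
  unfold gravity pStar qStar
  rw [show ((1 : ℝ) - 2 / 3) * (2 / 3) = 2 / 3 ^ 2 by norm_num, Real.sqrt_div (by norm_num),
    Real.sqrt_sq (by norm_num)]
  ring

theorem gravity_pos : 0 < gravity := by
  rw [gravity_eq]
  positivity

namespace Conf

variable [Fintype Proc]

/-- An exponential potential: it contracts on average by the factor `gravity` in a step from a
configuration that is not small. -/
def potential (γ : Conf Proc Var Val Reg Lbl) : ℝ≥0∞ := ENNReal.ofReal (√2 ^ (γ.size - 4))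

theorem potential_le_of_size_le {γ : Conf Proc Var Val Reg Lbl} {k : ℕ} (h : γ.size ≤ k) :
    γ.potential ≤ ENNReal.ofReal (√2 ^ (k - 4)) := by
  refine ENNReal.ofReal_le_ofReal (pow_le_pow_right₀ ?_ (by omega))
  exact Real.one_le_sqrt.2 (by norm_num)

theorem size_getD_flushWord {γ : Conf Proc Var Val Reg Lbl} {w : List Proc}
    (hw : w ∈ γ.updateWords) : ((γ.flushWord w).getD γ).size + w.length = γ.size := by
  obtain ⟨δ, hδ⟩ := Option.isSome_iff_exists.1 (show (γ.flushWord w).isSome from hw)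
  rw [hδ]
  exact size_flushWord w hδ

theorem updateWords_nonempty (γ : Conf Proc Var Val Reg Lbl) :
    γ.finite_updateWords.toFinset.Nonempty :=
  ⟨[], by simp [updateWords, flushWord]⟩

theorem updatePMF_eq (γ : Conf Proc Var Val Reg Lbl) :
    γ.updatePMF = (PMF.uniformOfFinset γ.finite_updateWords.toFinset γ.updateWords_nonempty).map
      fun w => (γ.flushWord w).getD γ :=
  rfl

theorem tsum_updatePMF_mul_potential_le_of_small (γ : Conf Proc Var Val Reg Lbl)
    (h : γ.size ≤ 5) : ∑' δ, γ.updatePMF δ * δ.potential ≤ ENNReal.ofReal √2 := by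
  rw [updatePMF_eq, tsum_map_mul]
  refine tsum_mul_le_of_support _ fun w hw => ?_
  rw [PMF.support_uniformOfFinset] at hw
  have := size_getD_flushWord (w := w) (γ := γ) (by simpa using hw)
  exact (potential_le_of_size_le (k := 5) (by omega)).trans_eq (by norm_num)

theorem tsum_updatePMF_mul_potential_le (γ : Conf Proc Var Val Reg Lbl) {s : ℕ} (hs : 5 ≤ s)
    (h : γ.size = s ∨ γ.size = s + 1) :
    ∑' δ, γ.updatePMF δ * δ.potential ≤ ENNReal.ofReal (gravity * √2 ^ (s - 4)) := by
  classical
  have h3 := three_mul_card_filter_le γ hs h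
  rw [updatePMF_eq, tsum_map_mul]
  have hmemW : ∀ w ∈ γ.finite_updateWords.toFinset, w ∈ γ.updateWords := by simp
  have hW0 := γ.updateWords_nonempty
  change ∑' w, PMF.uniformOfFinset _ hW0 w * _ ≤ _
  revert h3 hmemW hW0
  generalize γ.finite_updateWords.toFinset = W
  intro h3 hmemW hW0
  set N := W.card with hN
  set A := W.filter fun w => w.length < γ.size + 1 - s with hA
  have hN0 : 0 < N := Finset.card_pos.2 hW0
  have hr : √(2 : ℝ) * √2 = 2 := Real.mul_self_sqrt (by norm_num)
  set u : ℝ := √2 ^ (s - 5) with hu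
  have hu0 : 0 < u := by positivity
  have hmem : ∀ w ∈ W, ((γ.flushWord w).getD γ).potential ≤
      ENNReal.ofReal (u * (1 + if w.length < γ.size + 1 - s then 1 else 0)) := by
    intro w hw
    have hw' := size_getD_flushWord (hmemW w hw)
    -- A short word leaves size at most `s + 1`, hence potential at most 2u; any other leaves at
    -- most `s - 1`, hence at most u. As `s - 1 ≥ 4`, the truncated exponent loses nothing here.
    split_ifs with hl
    · refine (potential_le_of_size_le (k := s + 1) (by omega)).trans_eq ?_
      rw [show s + 1 - 4 = s - 5 + 1 + 1 by omega, pow_succ, pow_succ, mul_assoc, hr, one_add_one_eq_two]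
    · refine (potential_le_of_size_le (k := s - 1) (by omega)).trans_eq ?_
      rw [show s - 1 - 4 = s - 5 by omega]
      norm_num [hu]
  rw [tsum_eq_sum (s := W) (fun w hw => by
    rw [PMF.uniformOfFinset_apply_of_notMem _ hw, zero_mul])]
  calc ∑ w ∈ W, PMF.uniformOfFinset W _ w * ((γ.flushWord w).getD γ).potential
      ≤ ∑ w ∈ W, (N : ℝ≥0∞)⁻¹ *
          ENNReal.ofReal (u * (1 + if w.length < γ.size + 1 - s then 1 else 0)) := by
        refine Finset.sum_le_sum fun w hw => ?_
        rw [PMF.uniformOfFinset_apply_of_mem _ hw]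
        gcongr
        exact hmem w hw
    _ = (N : ℝ≥0∞)⁻¹ * ENNReal.ofReal (u * (N + A.card)) := by
        rw [← Finset.mul_sum, ← ENNReal.ofReal_sum_of_nonneg, ← Finset.mul_sum,
          Finset.sum_add_distrib, Finset.sum_boole]
        · simp [hN, hA]
        · intro w _
          split_ifs <;> positivity
    _ ≤ (N : ℝ≥0∞)⁻¹ * ENNReal.ofReal (N * (gravity * √2 ^ (s - 4))) := by
        refine mul_le_mul_right (ENNReal.ofReal_le_ofReal ?_) _
        rw [gravity_eq, show s - 4 = s - 5 + 1 by omega, pow_succ, ← hu]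
        have h3' : 3 * (A.card : ℝ) ≤ N := by exact_mod_cast h3
        have : (N : ℝ) * (2 / 3 * √2 * (u * √2)) = u * (N * (4 / 3)) := by
          linear_combination (N : ℝ) * (2 / 3) * u * hr
        rw [this]
        gcongr
        linarith
    _ = ENNReal.ofReal (gravity * √2 ^ (s - 4)) := by
        rw [ENNReal.ofReal_mul (by positivity), ENNReal.ofReal_natCast, ← mul_assoc,
          ENNReal.inv_mul_cancel (by exact_mod_cast hN0.ne') (by simp), one_mul]

end Conf

/-! ### One step of the Markov chain -/

namespace Program

variable (P : Program Proc Var Val Reg Lbl) [Fintype Proc]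

/-- Only a write changes a buffer, and it appends a single entry. -/
theorem size_procStep {γ δ : Conf Proc Var Val Reg Lbl} {p : Proc}
    (h : P.procStep γ p = some δ) : δ.size = γ.size ∨ δ.size = γ.size + 1 := by
  classical
  have hsame : ∀ {δ : Conf Proc Var Val Reg Lbl}, δ.buf = γ.buf → δ.size = γ.size := by
    intro δ hδ
    simp [Conf.size, hδ]
  unfold procStep at h
  cases hc : P.code p (γ.lbl p) with
  | write x e =>
    right
    simp only [hc, Option.some.injEq] at h
    subst h
    unfold Conf.size
    rw [← Finset.add_sum_erase Finset.univ (fun q => (γ.buf q).length) (Finset.mem_univ p),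
      ← Finset.add_sum_erase Finset.univ _ (Finset.mem_univ p)]
    rw [Finset.sum_congr rfl (g := fun q => (γ.buf q).length)]
    · simp [Conf.setBuf]
      omega
    · intro q hq
      simp [Conf.setBuf, Conf.setLbl, Function.update_of_ne (Finset.ne_of_mem_erase hq)]
  | read a x =>
    simp only [hc, Option.some.injEq] at h
    subst h
    exact .inl (hsame rfl)
  | assign a e =>
    simp only [hc, Option.some.injEq] at h
    subst h
    exact .inl (hsame rfl)
  | branch b l =>
    simp only [hc, Option.some.injEq] at h
    subst h
    refine .inl (hsame ?_)
    split_ifs <;> rfl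
  | cas x e e' =>
    simp only [hc] at h
    split_ifs at h
    simp only [Option.some.injEq] at h
    subst h
    exact .inl (hsame rfl)
  | tryCas x e e' f =>
    simp only [hc] at h
    split_ifs at h <;>
    · simp only [Option.some.injEq] at h
      subst h
      exact .inl (hsame rfl)
  | term => simp [hc] at h

theorem size_of_mem_support_procPMF {γ δ : Conf Proc Var Val Reg Lbl}
    (h : δ ∈ (P.procPMF γ).support) : δ.size = γ.size ∨ δ.size = γ.size + 1 := by
  unfold procPMF at h
  split_ifs at h
  · rw [PMF.mem_support_map_iff] at h
    obtain ⟨p, -, rfl⟩ := h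
    cases hp : P.procStep γ p with
    | none => simp
    | some δ => exact P.size_procStep hp
  · rw [PMF.mem_support_pure_iff] at h
    simp [h]

open scoped Classical in
/-- The factor by which the potential grows on average, at most. -/
def growth (γ : Conf Proc Var Val Reg Lbl) : ℝ := if γ.Small then √2 else gravity

theorem growth_pos (γ : Conf Proc Var Val Reg Lbl) : 0 < growth γ := by
  unfold growth
  split_ifs
  · positivity
  · exact gravity_pos

theorem lintegral_potential_stepPMF_le (γ : Conf Proc Var Val Reg Lbl) :
    ∫⁻ δ, δ.potential ∂(P.stepPMF γ).toMeasure ≤ ENNReal.ofReal (growth γ) * γ.potential := by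
  rw [lintegral_toMeasure _ measurable_from_top, stepPMF, tsum_bind_mul]
  refine tsum_mul_le_of_support _ fun δ hδ => ?_
  have hs := P.size_of_mem_support_procPMF hδ
  by_cases h : γ.Small
  · have h4 : γ.size ≤ 4 := h
    refine (δ.tsum_updatePMF_mul_potential_le_of_small (by omega)).trans_eq ?_
    simp [growth, h, Conf.potential, Nat.sub_eq_zero_of_le h4]
  · have h4 : ¬ γ.size ≤ 4 := h
    refine (δ.tsum_updatePMF_mul_potential_le (s := γ.size) (by omega) hs).trans_eq ?_
    simp [growth, h, Conf.potential, ENNReal.ofReal_mul gravity_pos.le]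

/-! ### Runs -/

/-- The Markov property as a disintegration: it lets the induction below integrate out the next
configuration given the history. -/
theorem runMeasure_map (γ : Conf Proc Var Val Reg Lbl) (n : ℕ) :
    (P.runMeasure γ).map (fun ρ => (Preorder.frestrictLe n ρ, ρ (n + 1))) =
      ((P.runMeasure γ).map (Preorder.frestrictLe n)) ⊗ₘ P.stepKernel n := by
  unfold runMeasure
  rw [← Kernel.partialTraj_compProd_eq_map_traj (Nat.zero_le n),
    Kernel.traj_map_frestrictLe_apply]

/-- The potential divided by the growth factors of the past is a supermartingale. -/
theorem lintegral_prod_mul_potential_le (γ : Conf Proc Var Val Reg Lbl) (hγ : γ.Small) (n : ℕ) :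
    ∫⁻ ρ, (∏ i ∈ Finset.range n, (ENNReal.ofReal (growth (ρ i)))⁻¹) * (ρ n).potential
      ∂P.runMeasure γ ≤ 1 := by
  have hm : ∀ g : Conf Proc Var Val Reg Lbl → ℝ≥0∞, Measurable g := fun _ => measurable_from_top
  induction n with
  | zero =>
    have h0 : (P.runMeasure γ).map (fun ρ => Preorder.frestrictLe 0 ρ) =
        Measure.dirac fun _ => γ := by
      unfold runMeasure
      rw [Kernel.traj_map_frestrictLe_apply, Kernel.partialTraj_self, Kernel.id_apply]
    have hf : Measurable fun x : Π _ : Finset.Iic 0, Conf Proc Var Val Reg Lbl =>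
        (x ⟨0, Finset.mem_Iic.2 le_rfl⟩).potential :=
      (hm Conf.potential).comp (measurable_pi_apply _)
    have h1 := lintegral_map (μ := P.runMeasure γ) hf (Preorder.measurable_frestrictLe 0)
    have h4 : γ.size ≤ 4 := hγ
    rw [h0, lintegral_dirac' _ hf] at h1
    simp only [Finset.range_zero, Finset.prod_empty, one_mul]
    refine h1.symm.le.trans ?_
    simp [Conf.potential, Nat.sub_eq_zero_of_le h4]
  | succ n ih =>
    -- The discount at time `n + 1` depends only on the history up to `n`, so it leaves the inner
    -- integral; its last factor cancels the growth of that step.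
    let D : (Π _ : Finset.Iic n, Conf Proc Var Val Reg Lbl) → ℝ≥0∞ := fun x =>
      ∏ i : Finset.Iic n, (ENNReal.ofReal (growth (x i)))⁻¹
    have hD : Measurable D := Finset.measurable_prod _ fun i _ =>
      (hm fun δ => (ENNReal.ofReal (growth δ))⁻¹).comp (measurable_pi_apply i)
    have hD' : ∀ ρ : ℕ → Conf Proc Var Val Reg Lbl, D (Preorder.frestrictLe n ρ) =
        ∏ i ∈ Finset.range (n + 1), (ENNReal.ofReal (growth (ρ i)))⁻¹ := by
      intro ρ
      rw [Nat.range_succ_eq_Iic, ← Finset.prod_coe_sort]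
      rfl
    have hF : Measurable fun y : (Π _ : Finset.Iic n, Conf Proc Var Val Reg Lbl) ×
        Conf Proc Var Val Reg Lbl => D y.1 * y.2.potential :=
      (hD.comp measurable_fst).mul ((hm Conf.potential).comp measurable_snd)
    have hr : Measurable fun ρ : ℕ → Conf Proc Var Val Reg Lbl =>
        (Preorder.frestrictLe n ρ, ρ (n + 1)) :=
      (Preorder.measurable_frestrictLe n).prodMk (measurable_pi_apply _)
    have h1 := lintegral_map (μ := P.runMeasure γ) hF hr
    simp only [hD'] at h1
    have hprob : IsProbabilityMeasure (P.runMeasure γ) := by unfold runMeasure; infer_instance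
    have hprob' := Measure.isProbabilityMeasure_map (μ := P.runMeasure γ)
      (Preorder.measurable_frestrictLe (X := fun _ => Conf Proc Var Val Reg Lbl) n).aemeasurable
    rw [← h1, runMeasure_map, Measure.lintegral_compProd hF,
      lintegral_map hF.lintegral_kernel_prod_right' (Preorder.measurable_frestrictLe n)]
    refine le_trans (lintegral_mono fun ρ => ?_) ih
    change ∫⁻ δ, D (Preorder.frestrictLe n ρ) * δ.potential ∂(P.stepPMF (ρ n)).toMeasure ≤ _
    rw [lintegral_const_mul _ (hm _), hD', Finset.prod_range_succ, mul_assoc]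
    gcongr
    have hg : ENNReal.ofReal (growth (ρ n)) ≠ 0 := by simp [growth_pos]
    calc _ ≤ (ENNReal.ofReal (growth (ρ n)))⁻¹ *
          (ENNReal.ofReal (growth (ρ n)) * (ρ n).potential) := by
            gcongr
            exact P.lintegral_potential_stepPMF_le (ρ n)
      _ = (ρ n).potential := by
            rw [← mul_assoc, ENNReal.inv_mul_cancel hg (by simp), one_mul]

theorem prod_growth (n : ℕ) (ρ : ℕ → Conf Proc Var Val Reg Lbl) :
    ∏ i ∈ Finset.range n, growth (ρ i) = gravity ^ n * (3 / 2) ^ smallVisits n ρ := by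
  classical
  have : ∀ i, growth (ρ i) = gravity * if (ρ i).Small then 3 / 2 else 1 := by
    intro i
    unfold growth
    split_ifs
    · rw [gravity_eq]; ring
    · ring
  simp_rw [this]
  rw [Finset.prod_mul_distrib, Finset.prod_ite]
  simp only [Finset.prod_const, Finset.card_range, one_pow, mul_one, smallVisits]

theorem runMeasure_smallVisits_le (γ : Conf Proc Var Val Reg Lbl) (hγ : γ.Small) (n k : ℕ) :
    P.runMeasure γ {ρ | smallVisits n ρ ≤ k} ≤ ENNReal.ofReal (gravity ^ n * (3 / 2) ^ k) := by
  set b : ℝ := gravity ^ n * (3 / 2) ^ k with hb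
  have hb0 : 0 < b := mul_pos (pow_pos gravity_pos n) (by positivity)
  have hm : ∀ g : Conf Proc Var Val Reg Lbl → ℝ≥0∞, Measurable g := fun _ => measurable_from_top
  have hF : Measurable fun ρ : ℕ → Conf Proc Var Val Reg Lbl =>
      (∏ i ∈ Finset.range n, (ENNReal.ofReal (growth (ρ i)))⁻¹) * (ρ n).potential :=
    (Finset.measurable_prod _ fun i _ =>
      (hm fun δ => (ENNReal.ofReal (growth δ))⁻¹).comp (measurable_pi_apply i)).mul
      ((hm Conf.potential).comp (measurable_pi_apply n))
  have hb1 : ENNReal.ofReal b ≠ 0 := by simp [hb0]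
  have h1 := (mul_meas_ge_le_lintegral (μ := P.runMeasure γ) hF (ENNReal.ofReal b)⁻¹).trans
    (P.lintegral_prod_mul_potential_le γ hγ n)
  have h2 : {ρ : ℕ → Conf Proc Var Val Reg Lbl | smallVisits n ρ ≤ k} ⊆
      {ρ | (ENNReal.ofReal b)⁻¹ ≤
        (∏ i ∈ Finset.range n, (ENNReal.ofReal (growth (ρ i)))⁻¹) * (ρ n).potential} := by
    intro ρ hρ
    have hρ' : smallVisits n ρ ≤ k := hρ
    -- Truncated subtraction keeps the exponent nonnegative even for sizes below 4.
    have hpot : 1 ≤ (ρ n).potential := by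
      rw [Conf.potential, ENNReal.one_le_ofReal]
      exact one_le_pow₀ (Real.one_le_sqrt.2 (by norm_num))
    have hprod : ∏ i ∈ Finset.range n, (ENNReal.ofReal (growth (ρ i)))⁻¹ =
        ENNReal.ofReal (gravity ^ n * (3 / 2) ^ smallVisits n ρ)⁻¹ := by
      rw [← prod_growth, ← Finset.prod_inv_distrib,
        ENNReal.ofReal_prod_of_nonneg fun i _ => (inv_pos.2 (growth_pos _)).le]
      exact Finset.prod_congr rfl fun i _ => (ENNReal.ofReal_inv_of_pos (growth_pos _)).symm
    rw [Set.mem_ofPred_eq, hprod, ← ENNReal.ofReal_inv_of_pos hb0]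
    refine le_mul_of_le_of_one_le (ENNReal.ofReal_le_ofReal ?_) hpot
    have hg := gravity_pos
    rw [hb]
    gcongr
    norm_num
  calc P.runMeasure γ {ρ | smallVisits n ρ ≤ k} ≤ P.runMeasure γ _ := measure_mono h2
    _ ≤ ENNReal.ofReal b := by
      rw [mul_comm, ← div_eq_mul_inv] at h1
      simpa using (ENNReal.div_le_iff hb1 (by simp)).1 h1

end Program

/-! ### Constants -/

theorem alphaOne_eq {β : ℝ} (hβ : 1 < β) :
    alphaOne β = β / (β - 1) * (2 * β) ^ (1 / β) * gravity := by
  have : ⌊1 / β⌋₊ = 0 := by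
    rw [Nat.floor_eq_zero, div_lt_one (by linarith)]
    exact hβ
  rw [alphaOne, this, pow_zero, mul_one]

/-- There is slack: 3/2 ≤ 2β, and the factor β/(β - 1) is at least 1. -/
theorem gravity_pow_mul_le_alphaOne_pow {β : ℝ} (hβ : 1 < β) (n : ℕ) :
    gravity ^ n * (3 / 2) ^ ⌊(n : ℝ) / β⌋₊ ≤ alphaOne β ^ n := by
  have hβ0 : 0 < β := by linarith
  have hβ1 : 0 < β - 1 := by linarith
  have hg := gravity_pos
  have h1 : 1 ≤ β / (β - 1) := by
    rw [one_le_div hβ1]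
    linarith
  have h2 : (3 / 2 : ℝ) ^ ⌊(n : ℝ) / β⌋₊ ≤ ((2 * β) ^ (1 / β)) ^ n := by
    calc (3 / 2 : ℝ) ^ ⌊(n : ℝ) / β⌋₊ ≤ (2 * β) ^ ⌊(n : ℝ) / β⌋₊ := by
          gcongr
          linarith
      _ = (2 * β) ^ (⌊(n : ℝ) / β⌋₊ : ℝ) := (Real.rpow_natCast _ _).symm
      _ ≤ (2 * β) ^ ((n : ℝ) / β) :=
          Real.rpow_le_rpow_of_exponent_le (by linarith) (Nat.floor_le (by positivity))
      _ = ((2 * β) ^ (1 / β)) ^ n := by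
          rw [← Real.rpow_natCast, ← Real.rpow_mul (by positivity)]
          ring_nf
  rw [alphaOne_eq hβ, mul_pow, mul_pow, mul_comm]
  gcongr
  exact h2.trans (le_mul_of_one_le_left (by positivity) (one_le_pow₀ h1))

theorem alphaOne_lt_one : alphaOne 150 < 1 := by
  rw [alphaOne_eq (by norm_num), gravity_eq]
  -- Equivalent to 300 ≤ 1.04 ^ 150; the final product is then about 0.991.
  have h1 : ((2 : ℝ) * 150) ^ (1 / 150 : ℝ) ≤ 104 / 100 := by
    rw [show (1 / 150 : ℝ) = ((150 : ℕ) : ℝ)⁻¹ by norm_num,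
      Real.rpow_inv_le_iff_of_pos (by norm_num) (by norm_num) (by norm_num), Real.rpow_natCast]
    norm_num
  have h2 : √2 < 142 / 100 := (Real.sqrt_lt' (by norm_num)).2 (by norm_num)
  calc (150 : ℝ) / (150 - 1) * (2 * 150) ^ (1 / 150 : ℝ) * (2 / 3 * √2)
      ≤ 150 / (150 - 1) * (104 / 100) * (2 / 3 * (142 / 100)) := by gcongr
    _ < 1 := by norm_num

end PTSO

end

theorem mainTheorem11 {Proc Var Val : Type*} {Reg Lbl : Proc → Type*}
    [Fintype Proc] [Finite Var] [Finite Val] [∀ p, Finite (Reg p)] [∀ p, Finite (Lbl p)]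
    (P : PTSO.Program Proc Var Val Reg Lbl) :
    (∀ (l : Σ p, Lbl p) (γ : PTSO.Conf Proc Var Val Reg Lbl), γ.Small →
      ∀ β : ℝ, 1 < β → ∀ n : ℕ,
        P.runMeasure γ (PTSO.sRuns l β n) ≤ ENNReal.ofReal (PTSO.alphaOne β ^ n)) ∧
    PTSO.alphaOne 150 < 1 := by
  refine ⟨fun l γ hγ β hβ n => ?_, PTSO.alphaOne_lt_one⟩
  calc P.runMeasure γ (PTSO.sRuns l β n)
      ≤ P.runMeasure γ {ρ | PTSO.smallVisits n ρ ≤ ⌊(n : ℝ) / β⌋₊} :=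
        measure_mono fun ρ hρ => hρ.2
    _ ≤ _ := P.runMeasure_smallVisits_le γ hγ n _
    _ ≤ _ := ENNReal.ofReal_le_ofReal (PTSO.gravity_pow_mul_le_alphaOne_pow hβ n)
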